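/- Let $H$ be an infinite-dimensional complex Hilbert space and let $f:\mathbb R\to\mathbb C$ be a continuous function. Suppose that for arbitrary compact self-adjoint operators $A$ and $B$ on $H$ the following implication holds: if $A-B$ is of trace class, then $f(A)-f(B)$ is of trace class. (Here $f(A)$ and $f(B)$ are defined by the functional calculus, and a bounded operator $T$ on $H$ is of trace class if $|T|=(T^*T)^{1/2}$ has finite trace, i.e. $\sum_i\langle |T|e_i,e_i\rangle<\infty$ for an orthonormal basis $(e_i)$ of $H$.) Then $f$ is differentiable in a neighbourhood of the origin, i.e. there is $\varepsilon>0$ such that $f$ is differentiable at every point of $(-\varepsilon,\varepsilon)$. -/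

import Mathlib

open scoped InnerProductSpace Topology

noncomputable section

universe u

/-- A bounded operator `T` on a complex Hilbert space is of trace class if the trace
`∑ ⟪e i, |T| (e i)⟫` of `|T| = (T⋆ T)^(1/2)` in an orthonormal basis `e` is finite. The terms are
nonnegative reals and the sum is the same in every orthonormal basis. -/
def IsTraceClass {H : Type u} [NormedAddCommGroup H] [InnerProductSpace ℂ H] [CompleteSpace H]
    (T : H →L[ℂ] H) : Prop :=
  ∃ (ι : Type u) (e : HilbertBasis ι ℂ H),
    Summable fun i : ι => (⟪e i, CFC.abs T (e i)⟫_ℂ).re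

/-- The operator `f(A)` for a continuous complex-valued function `f` on the real line and a bounded
self-adjoint operator `A`, given by the continuous functional calculus. The complex functional
calculus is used because `f` has complex values; the spectrum of `A` is real, so only the values
of `f` on that spectrum matter. -/
def opFun {H : Type u} [NormedAddCommGroup H] [InnerProductSpace ℂ H] [CompleteSpace H]
    (f : ℝ → ℂ) (A : H →L[ℂ] H) : H →L[ℂ] H :=
  cfc (fun z : ℂ => f z.re) A

/-- For all compact self-adjoint operators `A`, `B` on `H`: if `A - B` is of trace class, then so
is `f(A) - f(B)`. -/
def CompactRespectsTraceClass (H : Type u) [NormedAddCommGroup H] [InnerProductSpace ℂ H]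
    [CompleteSpace H] (f : ℝ → ℂ) : Prop :=
  ∀ A B : H →L[ℂ] H, IsSelfAdjoint A → IsSelfAdjoint B →
    IsCompactOperator A → IsCompactOperator B →
    IsTraceClass (A - B) → IsTraceClass (opFun f A - opFun f B)

end

/-!
If `f` is not differentiable at points accumulating at `0`, a compact self-adjoint `A` and a unitary
`U` are constructed such that `A - U A U⋆` is of trace class but `f(A) - f(U A U⋆)` is not.

The problem is first linearized. For a self-adjoint `L` with Cayley transform `U`, the commutators
of an operator with `U` and with `L` differ only by bounded factors (`exists_cayley`). Since
`f(U A U⋆) = U f(A) U⋆`, the hypothesis says that `f(A) L - L f(A)` is of trace class whenever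
`A L - L A` is (`CompactRespectsTraceClass.hasBoundedDiagonals_commutator`). If `A` has the
eigenvectors `e i`, `e' j` with eigenvalues `s i`, `t j`, and `L` has the entries `c / (s i - t j)`
between them, then `A L - L A` has constant entries `c`, so a block with `n` nodes of each kind has
trace norm `2 n c`, while the entries of `f(A) L - L f(A)` are `c` times the divided differences
of `f` at the nodes.

Near a point where `f` is not differentiable the divided differences can be made to behave badly. If
the difference quotients are unbounded, a single pair of nodes suffices. Otherwise they have
two cluster values `a ≠ b`, and for lacunary nodes the matrix of divided differences is close to the
matrix with entries `a` for `i ≤ j` and `b` for `j < i` (`exists_lacunary_nodes`). The trace norm of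
this triangular matrix is of order `n log n`, which is visible already on its diagonal in the
Fourier basis (`le_sum_norm_fourier`).

Orthogonal sums of many copies of such blocks, with small weights and with nodes tending to `0`,
then contradict the commutator form of the hypothesis (`CompactRespectsTraceClass.false_of_nodes`).

Trace class operators enter only through `HasBoundedDiagonals`, an equivalent condition on sums
`∑ |⟪g i, P T Q (h i)⟫|` for orthonormal families, for which the ideal property and the closure
under absolutely convergent series are evident.
-/

open scoped InnerProductSpace Topology
open Filter InnerProductSpace

section

variable {H : Type*} [NormedAddCommGroup H] [InnerProductSpace ℂ H] [CompleteSpace H]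

/-! ### Trace class operators and diagonal sums -/

/-- Parseval's identity. -/
theorem HilbertBasis.hasSum_norm_inner_sq {H ι : Type*} [NormedAddCommGroup H]
    [InnerProductSpace ℂ H] (e : HilbertBasis ι ℂ H) (x : H) :
    HasSum (fun i => ‖⟪e i, x⟫_ℂ‖ ^ 2) (‖x‖ ^ 2) := by
  have h := Complex.hasSum_re (e.hasSum_inner_mul_inner x x)
  convert h using 1
  · ext i
    rw [← inner_conj_symm x (e i), ← Complex.normSq_eq_conj_mul_self, Complex.ofReal_re,
      Complex.normSq_eq_norm_sq]
  · rw [inner_self_eq_norm_sq_to_K]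
    norm_cast

/-- An approximate polar decomposition: with `V = T (|T| + ε)⁻¹` one has `V |T| = T - ε V` and `V⋆ T
= |T| - ε (|T| + ε)⁻¹ |T|`, and both errors have norm at most `ε`. This avoids constructing the
partial isometry of the polar decomposition. -/
theorem exists_approx_polar (T : H →L[ℂ] H) {ε : ℝ} (hε : 0 < ε) :
    ∃ V : H →L[ℂ] H, ‖V‖ ≤ 1 ∧ ‖T - V * CFC.abs T‖ ≤ ε ∧ ‖CFC.abs T - star V * T‖ ≤ ε := by
  set B := CFC.abs T with hB
  have hB0 : 0 ≤ B := CFC.abs_nonneg T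
  have hBsa : IsSelfAdjoint B := .of_nonneg hB0
  have hspec : ∀ x ∈ spectrum ℝ B, 0 ≤ x := fun x hx => spectrum_nonneg_of_nonneg hB0 hx
  set G : H →L[ℂ] H := cfc (fun x : ℝ => (x + ε)⁻¹) B with hG
  have hGsa : IsSelfAdjoint G := cfc_predicate _ _
  have hcont : ContinuousOn (fun x : ℝ => (x + ε)⁻¹) (spectrum ℝ B) :=
    ContinuousOn.inv₀ (by fun_prop) fun x hx => by have := hspec x hx; positivity
  have hGB : G * B = cfc (fun x : ℝ => (x + ε)⁻¹ * x) B := by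
    conv_lhs => rw [hG]; arg 2; rw [← cfc_id ℝ B]
    rw [← cfc_mul _ _ B hcont (by fun_prop)]
    simp
  have hBG : B * G = G * B := by
    have h : Commute (cfc (fun x : ℝ => x) B) G := cfc_commute_cfc _ _ B
    rwa [cfc_id' ℝ B] at h
  have hGBε : G * B + ε • G = 1 := by
    rw [hGB, hG, ← cfc_smul ε _ B hcont, ← cfc_add (a := B) (fun x : ℝ => (x + ε)⁻¹ * x)
      (fun x : ℝ => ε • (x + ε)⁻¹) (hcont.mul continuousOn_id) (hcont.const_smul ε),
      ← cfc_one ℝ B]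
    refine cfc_congr fun x hx => ?_
    have := hspec x hx
    have : x + ε ≠ 0 := by positivity
    simp only [smul_eq_mul, Pi.one_apply]
    field_simp
  have hGBn : ‖G * B‖ ≤ 1 := by
    rw [hGB]
    refine norm_cfc_le zero_le_one fun x hx => ?_
    have := hspec x hx
    rw [Real.norm_of_nonneg (by positivity), inv_mul_le_iff₀ (by positivity)]
    linarith
  have hVV : star (T * G) * (T * G) = star (G * B) * (G * B) := by
    calc star (T * G) * (T * G) = G * (star T * T) * G := by
          rw [star_mul, hGsa.star_eq]; noncomm_ring
      _ = G * (B * B) * G := by rw [← CFC.abs_mul_abs T]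
      _ = B * G * (G * B) := by rw [hBG, ← mul_assoc G B B, mul_assoc (G * B), hBG]
      _ = star (G * B) * (G * B) := by rw [star_mul, hGsa.star_eq, hBsa.star_eq]
  have hV : ‖T * G‖ ≤ 1 := by
    have h1 := CStarRing.norm_star_mul_self (x := T * G)
    rw [hVV, CStarRing.norm_star_mul_self] at h1
    nlinarith [norm_nonneg (T * G), norm_nonneg (G * B)]
  refine ⟨T * G, hV, ?_, ?_⟩
  · have : T - T * G * B = ε • (T * G) := by
      have := congrArg (T * ·) hGBε
      simp only [mul_add, mul_one, mul_smul_comm] at this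
      rw [mul_assoc, sub_eq_iff_eq_add', this]
    rw [this, norm_smul, Real.norm_of_nonneg hε.le]
    nlinarith
  · have : B - star (T * G) * T = ε • (G * B) := by
      have := congrArg (· * B) hGBε
      simp only [add_mul, one_mul, smul_mul_assoc] at this
      rw [star_mul, hGsa.star_eq, mul_assoc, ← CFC.abs_mul_abs T, ← hB, ← mul_assoc,
        sub_eq_iff_eq_add', this]
    rw [this, norm_smul, Real.norm_of_nonneg hε.le]
    nlinarith

/-- `C` bounds the trace norm of `T`, expressed by testing `T` on finite orthonormal families: every
diagonal sum of `P T Q` is at most `C ‖P‖ ‖Q‖`. The bounded operators `P` and `Q` are part of the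
definition so that the ideal property is immediate. -/
def DiagonalSumBound (T : H →L[ℂ] H) (C : ℝ) : Prop :=
  ∀ (n : ℕ) (g h : Fin n → H), Orthonormal ℂ g → Orthonormal ℂ h →
    ∀ P Q : H →L[ℂ] H, ∑ i, ‖⟪g i, P (T (Q (h i)))⟫_ℂ‖ ≤ C * ‖P‖ * ‖Q‖

/-- `T` has finite trace norm in the sense of `DiagonalSumBound`; this is equivalent to being of
trace class. -/
def HasBoundedDiagonals (T : H →L[ℂ] H) : Prop :=
  ∃ C : ℝ, 0 ≤ C ∧ DiagonalSumBound T C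

/-- The ideal property, which is why `P` and `Q` are built into `DiagonalSumBound`. -/
theorem HasBoundedDiagonals.mul_mul {T : H →L[ℂ] H} (hT : HasBoundedDiagonals T)
    (R S : H →L[ℂ] H) : HasBoundedDiagonals (R * T * S) := by
  obtain ⟨C, hC, h⟩ := hT
  refine ⟨C * ‖R‖ * ‖S‖, by positivity, fun n g g' hg hg' P Q => ?_⟩
  calc _ ≤ C * ‖P * R‖ * ‖S * Q‖ := h n g g' hg hg' (P * R) (S * Q)
    _ ≤ C * (‖P‖ * ‖R‖) * (‖S‖ * ‖Q‖) := by gcongr <;> exact norm_mul_le _ _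
    _ = _ := by ring

theorem HasBoundedDiagonals.exists_sum_le.{w, v} {H : Type v} [NormedAddCommGroup H]
    [InnerProductSpace ℂ H] [CompleteSpace H] {T : H →L[ℂ] H} (hT : HasBoundedDiagonals T) :
    ∃ C : ℝ, ∀ {κ : Type w} (g h : κ → H), Orthonormal ℂ g → Orthonormal ℂ h →
      ∀ P Q : H →L[ℂ] H, ‖P‖ ≤ 1 → ‖Q‖ ≤ 1 →
      ∀ F : Finset κ, ∑ i ∈ F, ‖⟪g i, P (T (Q (h i)))⟫_ℂ‖ ≤ C := by
  obtain ⟨C, hC, hb⟩ := hT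
  refine ⟨C, fun {κ} g h hg hh P Q hP hQ F => ?_⟩
  have hinj : Function.Injective fun j => (F.equivFin.symm j : κ) :=
    Subtype.val_injective.comp F.equivFin.symm.injective
  have := hb F.card _ _ (hg.comp _ hinj) (hh.comp _ hinj) P Q
  rw [← Finset.sum_coe_sort, ← F.equivFin.symm.sum_comp]
  refine this.trans ?_
  calc C * ‖P‖ * ‖Q‖ ≤ C * 1 * 1 := by gcongr
    _ = C := by ring

/-- A Hilbert–Schmidt estimate: an orthonormal family sees at most the sum of `‖R⋆ (e i)‖ ^ 2` over
a Hilbert basis. This makes the trace in one basis control every orthonormal family. -/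
theorem Orthonormal.sum_norm_apply_sq_le {ι κ : Type*} (e : HilbertBasis ι ℂ H)
    {g : κ → H} (hg : Orthonormal ℂ g) (R : H →L[ℂ] H) {a : ι → ℝ} {C : ℝ}
    (ha : HasSum a C) (hRa : ∀ i, ‖star R (e i)‖ ^ 2 ≤ a i) (F : Finset κ) :
    ∑ k ∈ F, ‖R (g k)‖ ^ 2 ≤ C := by
  have h1 : HasSum (fun i => ∑ k ∈ F, ‖⟪e i, R (g k)⟫_ℂ‖ ^ 2) (∑ k ∈ F, ‖R (g k)‖ ^ 2) :=
    hasSum_sum fun k _ => e.hasSum_norm_inner_sq (R (g k))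
  refine hasSum_le (fun i => ?_) h1 ha
  refine le_trans ?_ ((hg.sum_inner_products_le (star R (e i)) (s := F)).trans (hRa i))
  refine Finset.sum_le_sum fun k _ => le_of_eq ?_
  rw [ContinuousLinearMap.star_eq_adjoint, ContinuousLinearMap.adjoint_inner_right,
    ← inner_conj_symm, RCLike.norm_conj]

/-- Writing `T ≈ V |T|` and `|T| = S * S`, each diagonal entry is the inner product of `S (V⋆ P⋆ g
i)` and `S (Q (h i))`, so Cauchy–Schwarz and the Hilbert–Schmidt bound for `S` apply. -/
theorem IsTraceClass.hasBoundedDiagonals {T : H →L[ℂ] H} (hT : IsTraceClass T) :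
    HasBoundedDiagonals T := by
  obtain ⟨ι, e, hsum⟩ := hT
  set B := CFC.abs T with hB
  have hB0 : 0 ≤ B := CFC.abs_nonneg T
  set S := CFC.sqrt B with hS
  have hSsa : IsSelfAdjoint S := .of_nonneg (CFC.sqrt_nonneg B)
  have hSS : S * S = B := CFC.sqrt_mul_sqrt_self B
  have hSin : ∀ x y, ⟪x, B y⟫_ℂ = ⟪S x, S y⟫_ℂ := fun x y => by
    rw [← hSS, mul_apply_eq_comp, ← ContinuousLinearMap.adjoint_inner_left,
      ← ContinuousLinearMap.star_eq_adjoint, hSsa.star_eq]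
  have hterm : ∀ i, (⟪e i, B (e i)⟫_ℂ).re = ‖S (e i)‖ ^ 2 := fun i => by
    rw [hSin, inner_self_eq_norm_sq_to_K]; norm_cast
  simp only [hterm] at hsum
  obtain ⟨C, hC⟩ := hsum
  have hC0 : 0 ≤ C := hC.nonneg fun i => by positivity
  -- the Hilbert–Schmidt norm of `S * R` is at most `‖R‖` times that of `S`
  have hHS : ∀ (R : H →L[ℂ] H) {n : ℕ} (g : Fin n → H), Orthonormal ℂ g →
      ∑ k, ‖S (R (g k))‖ ^ 2 ≤ ‖R‖ ^ 2 * C := fun R n g hg => by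
    refine hg.sum_norm_apply_sq_le e (S * R) (hC.mul_left (‖R‖ ^ 2)) (fun i => ?_) Finset.univ
    rw [star_mul, hSsa.star_eq, mul_apply_eq_comp, ← mul_pow, ← norm_star R]
    gcongr
    exact (star R).le_opNorm _
  refine ⟨C, hC0, fun n g h hg hh P Q => ?_⟩
  have key : ∀ ε : ℝ, 0 < ε → ∑ i, ‖⟪g i, P (T (Q (h i)))⟫_ℂ‖ ≤
      C * ‖P‖ * ‖Q‖ + ε * (n * (‖P‖ * ‖Q‖)) := by
    intro ε hε
    obtain ⟨V, hV, hTV, -⟩ := exists_approx_polar T hε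
    have hi : ∀ i, ‖⟪g i, P (T (Q (h i)))⟫_ℂ‖ ≤
        ‖S ((star V * star P) (g i))‖ * ‖S (Q (h i))‖ + ε * (‖P‖ * ‖Q‖) := fun i => by
      have hsplit : ⟪g i, P (T (Q (h i)))⟫_ℂ =
          ⟪S ((star V * star P) (g i)), S (Q (h i))⟫_ℂ +
            ⟪g i, P ((T - V * B) (Q (h i)))⟫_ℂ := by
        rw [← hSin, mul_apply_eq_comp, ContinuousLinearMap.star_eq_adjoint,
          ContinuousLinearMap.star_eq_adjoint, ContinuousLinearMap.adjoint_inner_left,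
          ContinuousLinearMap.adjoint_inner_left, ← inner_add_right, ← map_add]
        simp
      rw [hsplit]
      refine (norm_add_le _ _).trans (add_le_add (norm_inner_le_norm _ _) ?_)
      refine (norm_inner_le_norm _ _).trans ?_
      rw [hg.1 i, one_mul]
      calc ‖P ((T - V * B) (Q (h i)))‖ ≤ ‖P‖ * (‖T - V * B‖ * (‖Q‖ * ‖h i‖)) := by
            refine (P.le_opNorm _).trans ?_
            gcongr
            refine ((T - V * B).le_opNorm _).trans ?_
            gcongr
            exact Q.le_opNorm _
        _ ≤ ‖P‖ * (ε * (‖Q‖ * 1)) := by rw [hh.1 i]; gcongr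
        _ = _ := by ring
    refine (Finset.sum_le_sum fun i _ => hi i).trans ?_
    rw [Finset.sum_add_distrib]
    refine add_le_add ?_ (le_of_eq ?_)
    · refine (Real.sum_mul_le_sqrt_mul_sqrt _ _ _).trans ?_
      have h1 : √(∑ i, ‖S ((star V * star P) (g i))‖ ^ 2) ≤ ‖P‖ * √C := by
        rw [Real.sqrt_le_left (by positivity), mul_pow, Real.sq_sqrt hC0]
        refine (hHS _ g hg).trans ?_
        gcongr
        refine (norm_mul_le _ _).trans ?_
        rw [norm_star, norm_star]
        nlinarith [norm_nonneg P]
      have h2 : √(∑ i, ‖S (Q (h i))‖ ^ 2) ≤ ‖Q‖ * √C := by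
        rw [Real.sqrt_le_left (by positivity), mul_pow, Real.sq_sqrt hC0]
        exact hHS _ h hh
      calc _ ≤ (‖P‖ * √C) * (‖Q‖ * √C) := by gcongr
        _ = (√C * √C) * ‖P‖ * ‖Q‖ := by ring
        _ = _ := by rw [Real.mul_self_sqrt hC0]
    · simp; ring
  refine ge_of_tendsto (x := 𝓝[>] (0 : ℝ))
    (f := fun ε : ℝ => C * ‖P‖ * ‖Q‖ + ε * (n * (‖P‖ * ‖Q‖))) ?_
    (eventually_nhdsWithin_of_forall key)
  have : Filter.Tendsto (fun ε : ℝ => C * ‖P‖ * ‖Q‖ + ε * (n * (‖P‖ * ‖Q‖))) (𝓝 0)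
      (𝓝 (C * ‖P‖ * ‖Q‖ + 0 * (n * (‖P‖ * ‖Q‖)))) :=
    Continuous.tendsto (by fun_prop) 0
  simpa using this.mono_left nhdsWithin_le_nhds

/-- The converse uses `|T| ≈ V⋆ T`, that is, `P = V⋆` and `Q = 1` in the bound. -/
theorem HasBoundedDiagonals.isTraceClass {T : H →L[ℂ] H} (hT : HasBoundedDiagonals T) :
    IsTraceClass T := by
  obtain ⟨w, e, -⟩ := exists_hilbertBasis ℂ H
  obtain ⟨C, hC⟩ := hT.exists_sum_le
  have hB0 : 0 ≤ CFC.abs T := CFC.abs_nonneg T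
  refine ⟨w, e, summable_of_sum_le (c := C) (fun i => ?_) fun F => ?_⟩
  · exact ((ContinuousLinearMap.nonneg_iff_isPositive _).1 hB0).re_inner_nonneg_right (e i)
  have key : ∀ ε : ℝ, 0 < ε →
      ∑ i ∈ F, (⟪e i, CFC.abs T (e i)⟫_ℂ).re ≤ C + ε * F.card := fun ε hε => by
    obtain ⟨V, hV, -, hTV⟩ := exists_approx_polar T hε
    have hi : ∀ i, (⟪e i, CFC.abs T (e i)⟫_ℂ).re ≤
        ‖⟪e i, star V (T ((1 : H →L[ℂ] H) (e i)))⟫_ℂ‖ + ε := fun i => by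
      have hsplit : ⟪e i, CFC.abs T (e i)⟫_ℂ = ⟪e i, star V (T ((1 : H →L[ℂ] H) (e i)))⟫_ℂ +
          ⟪e i, (CFC.abs T - star V * T) (e i)⟫_ℂ := by
        rw [← inner_add_right]; simp
      rw [hsplit, Complex.add_re]
      refine add_le_add (Complex.re_le_norm _) ((Complex.re_le_norm _).trans ?_)
      refine (norm_inner_le_norm _ _).trans ?_
      refine (mul_le_mul_of_nonneg_left (ContinuousLinearMap.le_opNorm _ _)
        (norm_nonneg _)).trans ?_
      simpa [e.orthonormal.1 i] using hTV
    refine (Finset.sum_le_sum fun i _ => hi i).trans ?_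
    rw [Finset.sum_add_distrib]
    refine add_le_add (hC e e e.orthonormal e.orthonormal (star V) 1 ?_ ?_ F) (le_of_eq ?_)
    · rwa [norm_star]
    · exact ContinuousLinearMap.norm_id_le
    · simp [mul_comm]
  refine ge_of_tendsto (x := 𝓝[>] (0 : ℝ)) (f := fun ε : ℝ => C + ε * F.card) ?_
    (eventually_nhdsWithin_of_forall key)
  have : Filter.Tendsto (fun ε : ℝ => C + ε * F.card) (𝓝 0) (𝓝 (C + 0 * F.card)) :=
    Continuous.tendsto (by fun_prop) 0
  simpa using this.mono_left nhdsWithin_le_nhds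

theorem DiagonalSumBound.add {H : Type*} [NormedAddCommGroup H] [InnerProductSpace ℂ H]
    {S T : H →L[ℂ] H} {C D : ℝ} (hS : DiagonalSumBound S C)
    (hT : DiagonalSumBound T D) : DiagonalSumBound (S + T) (C + D) := by
  intro n g h hg hh P Q
  calc _ ≤ ∑ i, (‖⟪g i, P (S (Q (h i)))⟫_ℂ‖ + ‖⟪g i, P (T (Q (h i)))⟫_ℂ‖) := by
        refine Finset.sum_le_sum fun i _ => ?_
        rw [add_apply, map_add, inner_add_right]
        exact norm_add_le _ _
    _ ≤ C * ‖P‖ * ‖Q‖ + D * ‖P‖ * ‖Q‖ := by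
        rw [Finset.sum_add_distrib]
        exact add_le_add (hS n g h hg hh P Q) (hT n g h hg hh P Q)
    _ = _ := by ring

theorem DiagonalSumBound.sum {H ι : Type*} [NormedAddCommGroup H] [InnerProductSpace ℂ H]
    {D : ι → H →L[ℂ] H} {C : ι → ℝ} (F : Finset ι)
    (hD : ∀ i, DiagonalSumBound (D i) (C i)) :
    DiagonalSumBound (∑ i ∈ F, D i) (∑ i ∈ F, C i) := by
  classical
  induction F using Finset.induction_on with
  | empty => intro n g h _ _ P Q; simp
  | insert a F ha ih => rw [Finset.sum_insert ha, Finset.sum_insert ha]; exact (hD a).add ih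

theorem DiagonalSumBound.hasSum {H ι : Type*} [NormedAddCommGroup H]
    [InnerProductSpace ℂ H] {D : ι → H →L[ℂ] H} {C : ι → ℝ} {T : H →L[ℂ] H}
    {c : ℝ} (hD : ∀ i, DiagonalSumBound (D i) (C i)) (hT : HasSum D T) (hC : HasSum C c) :
    DiagonalSumBound T c := by
  intro n g h hg hh P Q
  have hcont : Continuous fun T : H →L[ℂ] H => ∑ i, ‖⟪g i, P (T (Q (h i)))⟫_ℂ‖ := by fun_prop
  have hcont' : Continuous fun c : ℝ => c * ‖P‖ * ‖Q‖ := by fun_prop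
  exact le_of_tendsto_of_tendsto' ((hcont.tendsto T).comp hT) ((hcont'.tendsto c).comp hC)
    fun F => DiagonalSumBound.sum F hD n g h hg hh P Q

theorem DiagonalSumBound.rankOne (x y : H) : DiagonalSumBound (rankOne ℂ x y) (‖x‖ * ‖y‖) := by
  intro n g h hg hh P Q
  have hi : ∀ i, ‖⟪g i, P (InnerProductSpace.rankOne ℂ x y (Q (h i)))⟫_ℂ‖ =
      ‖⟪g i, P x⟫_ℂ‖ * ‖⟪h i, star Q y⟫_ℂ‖ := fun i => by
    rw [rankOne_apply, map_smul, inner_smul_right, norm_mul, mul_comm,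
      ContinuousLinearMap.star_eq_adjoint, ContinuousLinearMap.adjoint_inner_right,
      ← inner_conj_symm y, RCLike.norm_conj]
  have hbessel : ∀ (g : Fin n → H), Orthonormal ℂ g → ∀ z : H,
      √(∑ i, ‖⟪g i, z⟫_ℂ‖ ^ 2) ≤ ‖z‖ := fun g hg z => by
    rw [Real.sqrt_le_left (norm_nonneg z)]
    exact hg.sum_inner_products_le z
  simp only [hi]
  calc _ ≤ √(∑ i, ‖⟪g i, P x⟫_ℂ‖ ^ 2) * √(∑ i, ‖⟪h i, star Q y⟫_ℂ‖ ^ 2) :=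
        Real.sum_mul_le_sqrt_mul_sqrt _ _ _
    _ ≤ ‖P x‖ * ‖star Q y‖ := by gcongr <;> apply hbessel <;> assumption
    _ ≤ (‖P‖ * ‖x‖) * (‖star Q‖ * ‖y‖) := by
        gcongr <;> exact ContinuousLinearMap.le_opNorm _ _
    _ = _ := by rw [norm_star]; ring

/-! ### Functional calculus, commutators and the Cayley transform -/

theorem opFun_conj_unitary {f : ℝ → ℂ} (hf : Continuous f) {A U : H →L[ℂ] H}
    (hA : IsSelfAdjoint A) (hU : U ∈ unitary (H →L[ℂ] H)) :
    opFun f (U * A * star U) = U * opFun f A * star U := by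
  have hc : Continuous fun z : ℂ => f z.re := hf.comp Complex.continuous_re
  have hφ : Continuous (Unitary.conjStarAlgAut ℂ (H →L[ℂ] H) ⟨U, hU⟩) := by
    change Continuous fun x : H →L[ℂ] H => U * x * star U
    fun_prop
  have h := StarAlgHomClass.map_cfc (S := ℂ) (Unitary.conjStarAlgAut ℂ (H →L[ℂ] H) ⟨U, hU⟩)
    (fun z : ℂ => f z.re) A hc.continuousOn hφ hA.isStarNormal
    ((hA.conjugate U).isStarNormal)
  exact h.symm

/-- The functional calculus acts on eigenvectors as expected. -/
theorem opFun_apply_of_apply_eq_smul {f : ℝ → ℂ} (hf : Continuous f) {A : H →L[ℂ] H}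
    (hA : IsSelfAdjoint A) {v : H} {μ : ℝ} (hv : A v = (μ : ℂ) • v) :
    opFun f A v = f μ • v := by
  rcases eq_or_ne v 0 with rfl | hv0
  · simp
  have hμ : (μ : ℂ) ∈ spectrum ℂ A := by
    rw [spectrum.mem_iff]
    intro hu
    obtain ⟨W, hW⟩ := hu.exists_left_inv
    apply hv0
    have := congrArg (fun X : H →L[ℂ] H => X v) hW
    simpa [hv, Algebra.algebraMap_eq_smul_one] using this.symm
  have hAn : IsStarNormal A := hA.isStarNormal
  have key : ∀ g : C(spectrum ℂ A, ℂ), cfcHom hAn g v = g ⟨μ, hμ⟩ • v := by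
    intro g
    induction g using ContinuousMap.induction_on_of_compact with
    | const r =>
      have : ContinuousMap.const (spectrum ℂ A) r = algebraMap ℂ C(spectrum ℂ A, ℂ) r := rfl
      rw [this, AlgHomClass.commutes]
      simp [Algebra.algebraMap_eq_smul_one]
    | id => rw [cfcHom_id]; exact hv
    | star_id =>
      rw [map_star, cfcHom_id, hA.star_eq, hv]
      simp
    | add p q hp hq => rw [map_add, add_apply, hp, hq, ContinuousMap.add_apply, add_smul]
    | mul p q hp hq =>
      rw [map_mul, mul_apply_eq_comp, hq, map_smul, hp, ContinuousMap.mul_apply, smul_smul,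
        mul_comm]
    | frequently p hp =>
      have hclosed : IsClosed {q : C(spectrum ℂ A, ℂ) | cfcHom hAn q v = q ⟨μ, hμ⟩ • v} := by
        refine isClosed_eq ?_ ?_
        · exact (ContinuousLinearMap.apply ℂ H v).continuous.comp (cfcHom_continuous hAn)
        · exact (continuous_eval_const _).smul continuous_const
      exact hclosed.mem_of_frequently_of_tendsto hp Filter.tendsto_id
  have hc : ContinuousOn (fun z : ℂ => f z.re) (spectrum ℂ A) :=
    (hf.comp Complex.continuous_re).continuousOn
  rw [opFun, cfc_apply _ A hAn hc, key]
  simp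

/-- The Cayley transform `U = 2 (1 - i L)⁻¹ - 1` of a self-adjoint `L`. Commutators with `U` and
with `L` are obtained from each other by multiplying on both sides with fixed operators `R, R'` and
`S, S'`, so they generate the same two-sided ideal. -/
theorem exists_cayley {L : H →L[ℂ] H} (hL : IsSelfAdjoint L) :
    ∃ U ∈ unitary (H →L[ℂ] H), ∃ R R' S S' : H →L[ℂ] H, ∀ A : H →L[ℂ] H,
      A * U - U * A = R * (A * L - L * A) * R' ∧ A * L - L * A = S * (A * U - U * A) * S' := by
  set D : H →L[ℂ] H := 1 - Complex.I • L with hD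
  have hDstar : star D = 1 + Complex.I • L := by
    simp [hD, star_smul, hL.star_eq, sub_eq_add_neg]
  have hunit : IsUnit D := by
    have h : (-Complex.I) ∉ spectrum ℂ L := fun h => by
      have := hL.im_eq_zero_of_mem_spectrum h
      simp at this
    rw [spectrum.notMem_iff] at h
    have h2 : D = (Complex.I : ℂ) • (algebraMap ℂ (H →L[ℂ] H) (-Complex.I) - L) := by
      rw [hD, Algebra.algebraMap_eq_smul_one, smul_sub, smul_smul]
      simp
    rw [h2]
    have hI : IsUnit Complex.I := isUnit_iff_ne_zero.2 Complex.I_ne_zero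
    exact h.smul hI.unit
  obtain ⟨W, hWD, hDW⟩ : ∃ W, W * D = 1 ∧ D * W = 1 :=
    ⟨_, hunit.val_inv_mul, hunit.mul_val_inv⟩
  have hsum : star D = 2 - D := by rw [hDstar, hD, ← one_add_one_eq_two]; abel
  have hU : (2 • W - 1 : H →L[ℂ] H) = star D * W := by
    rw [hsum, sub_mul, hDW, two_smul, two_mul]
  have hU' : (2 • W - 1 : H →L[ℂ] H) = W * star D := by
    rw [hsum, mul_sub, hWD, two_smul, mul_two]
  have hWs : star W * star D = 1 := by rw [← star_mul, hDW, star_one]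
  have hWs' : star D * star W = 1 := by rw [← star_mul, hWD, star_one]
  have hIL : Complex.I • L = 1 - D := by rw [hD]; abel
  have hLI : L = -Complex.I • (1 - D) := by rw [← hIL, smul_smul]; simp
  have hcomm : ∀ A, A * L - L * A = Complex.I • (A * D - D * A) := fun A => by
    rw [hLI, mul_smul_comm, smul_mul_assoc, ← smul_sub, mul_sub, sub_mul, neg_smul, ← smul_neg]
    congr 1
    simp
  -- multiply `D * A - A * D` by the inverse `W` of `D` on both sides
  have hAW : ∀ A : H →L[ℂ] H, A * (2 • W - 1) - (2 • W - 1) * A =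
      2 • (W * (D * A - A * D) * W) := fun A => by
    have : W * (D * A - A * D) * W = A * W - W * A := by
      calc _ = (W * D) * A * W - W * A * (D * W) := by noncomm_ring
        _ = _ := by rw [hWD, hDW, one_mul, mul_one]
    rw [this, two_smul, two_smul]
    noncomm_ring
  refine ⟨2 • W - 1, ?_, (2 * Complex.I) • W, W, (-Complex.I / 2) • D, D, fun A => ⟨?_, ?_⟩⟩
  · rw [Unitary.mem_iff]
    constructor
    · conv_lhs => rw [hU]; arg 2; rw [← hU, hU']
      rw [star_mul, star_star]
      calc star W * D * (W * star D) = star W * (D * W) * star D := by noncomm_ring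
        _ = 1 := by rw [hDW, mul_one, hWs]
    · conv_lhs => rw [hU]; arg 2; rw [← hU, hU']
      rw [star_mul, star_star]
      calc star D * W * (D * star W) = star D * (W * D) * star W := by noncomm_ring
        _ = 1 := by rw [hWD, mul_one, hWs']
  · rw [hAW, hcomm, mul_smul_comm, smul_mul_assoc, smul_mul_assoc, smul_mul_assoc, smul_smul]
    have : Complex.I * (2 * Complex.I) = -2 := by linear_combination 2 * Complex.I_mul_I
    rw [this, ← neg_sub (A * D), mul_neg, neg_mul, neg_smul, smul_neg, two_smul, two_smul]
  · rw [hAW, hcomm, mul_smul_comm, smul_mul_assoc, smul_mul_assoc, smul_mul_assoc]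
    have : D * (W * (D * A - A * D) * W) * D = D * A - A * D := by
      calc _ = (D * W) * (D * A - A * D) * (W * D) := by noncomm_ring
        _ = _ := by rw [hWD, hDW, one_mul, mul_one]
    rw [this, ← Nat.cast_smul_eq_nsmul ℂ, smul_smul, ← neg_sub (A * D), smul_neg, ← neg_smul]
    congr 1
    push_cast; ring

/-- The commutator form of the hypothesis, obtained by comparing `A` with `U A U⋆`, where `U` is the
Cayley transform of `L`. -/
theorem CompactRespectsTraceClass.hasBoundedDiagonals_commutator {f : ℝ → ℂ} (hf : Continuous f)
    (ha : CompactRespectsTraceClass H f) {A L : H →L[ℂ] H} (hA : IsSelfAdjoint A)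
    (hAc : IsCompactOperator A) (hL : IsSelfAdjoint L)
    (hAL : HasBoundedDiagonals (A * L - L * A)) :
    HasBoundedDiagonals (opFun f A * L - L * opFun f A) := by
  obtain ⟨U, hU, R, R', S, S', h⟩ := exists_cayley hL
  have hconj : ∀ T : H →L[ℂ] H, T - U * T * star U = (T * U - U * T) * star U := fun T => by
    rw [sub_mul, mul_assoc T, Unitary.mul_star_self_of_mem hU, mul_one]
  have h1 : IsTraceClass (A - U * A * star U) := by
    apply HasBoundedDiagonals.isTraceClass
    rw [hconj, (h A).1]
    have := hAL.mul_mul R (R' * star U)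
    simpa only [mul_assoc] using this
  have hcomp : IsCompactOperator (U * A * star U : H →L[ℂ] H) :=
    (hAc.clm_comp U).comp_clm (star U)
  have h2 := (ha A (U * A * star U) hA (hA.conjugate U) hAc hcomp h1).hasBoundedDiagonals
  rw [opFun_conj_unitary hf hA hU, hconj] at h2
  rw [(h (opFun f A)).2]
  have := h2.mul_mul S (U * S')
  have hs : star U * (U * S') = S' := by
    rw [← mul_assoc, Unitary.star_mul_self_of_mem hU, one_mul]
  simpa only [mul_assoc, hs] using this

/-- The norm of a finite sum of pairwise orthogonal self-adjoint elements is the largest of their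
norms, so such a series converges as soon as its terms tend to zero. -/
theorem summable_of_isSelfAdjoint_of_mul_eq_zero {𝒜 ι : Type*} [NonUnitalCStarAlgebra 𝒜]
    {T : ι → 𝒜} (hT : ∀ i, IsSelfAdjoint (T i)) (hmul : Pairwise fun i j => T i * T j = 0)
    (hlim : Filter.Tendsto (fun i => ‖T i‖) Filter.cofinite (𝓝 0)) : Summable T := by
  rw [summable_iff_vanishing_norm]
  intro ε hε
  have hfin := hlim.eventually (gt_mem_nhds hε)
  rw [Filter.eventually_cofinite] at hfin
  refine ⟨hfin.toFinset, fun t ht => ?_⟩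
  have h := IsSelfAdjoint.nnnorm_sum_eq_sup t (fun i _ => hT i) hmul
  lift ε to NNReal using hε.le
  rw [← coe_nnnorm, h, NNReal.coe_lt_coe, Finset.sup_lt_iff (by exact_mod_cast hε)]
  intro i hi
  by_contra hcon
  exact Finset.disjoint_left.1 ht hi (by simpa [← NNReal.coe_le_coe] using hcon)

/-! ### Divided differences near a point of non-differentiability -/

theorem exists_two_mapClusterPt {α E : Type*} [NormedAddCommGroup E] [ProperSpace E]
    {l : Filter α} [l.NeBot] {q : α → E} {C : ℝ} (hb : ∀ᶠ h in l, ‖q h‖ ≤ C)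
    (hq : ¬ ∃ a, Tendsto q l (𝓝 a)) :
    ∃ a b, a ≠ b ∧ MapClusterPt a l q ∧ MapClusterPt b l q := by
  have hK : IsCompact (Metric.closedBall (0 : E) C) := isCompact_closedBall 0 C
  have hmem : Metric.closedBall (0 : E) C ∈ map q l := by
    rw [mem_map]
    filter_upwards [hb] with h hh
    simpa using hh
  obtain ⟨a, -, ha⟩ := hK.exists_clusterPt (f := map q l) (le_principal_iff.2 hmem)
  by_contra! hcon
  refine hq ⟨a, hK.le_nhds_of_unique_clusterPt hmem fun x _ hx => ?_⟩
  by_contra hne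
  exact hcon a x (Ne.symm hne) ha hx

/-- The divided difference `(f s - f t) / (s - t)`, with value `0` for `s = t`. -/
noncomputable def divDiff (f : ℝ → ℂ) (s t : ℝ) : ℂ := (f s - f t) / ((s - t : ℝ) : ℂ)

theorem tendsto_divDiff {f : ℝ → ℂ} (hf : Continuous f) {s x : ℝ} (hs : s ≠ x) :
    Tendsto (divDiff f s) (𝓝 x) (𝓝 (divDiff f s x)) := by
  have : ((s - x : ℝ) : ℂ) ≠ 0 := by exact_mod_cast sub_ne_zero.2 hs
  unfold divDiff
  refine ContinuousAt.tendsto (f := fun t => (f s - f t) / ((s - t : ℝ) : ℂ)) ?_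
  exact ContinuousAt.div (by fun_prop) (by fun_prop) this

/-- If the difference quotient of `f` at `x` has the cluster values `a` and `b`, nodes can be chosen
successively, each much closer to `x` than the previous ones, such that the matrix of divided
differences is nearly `a` on and above the diagonal and nearly `b` below it. -/
theorem exists_lacunary_nodes {f : ℝ → ℂ} (hf : Continuous f) {x : ℝ} {a b : ℂ}
    (ha : MapClusterPt a (𝓝[≠] x) fun t => divDiff f t x)
    (hb : MapClusterPt b (𝓝[≠] x) fun t => divDiff f t x)
    {U : Set ℝ} (hU : U ∈ 𝓝 x) {η : ℝ} (hη : 0 < η) :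
    ∃ s t : ℕ → ℝ, (∀ i, s i ∈ U) ∧ (∀ i, t i ∈ U) ∧ (∀ i j, s i ≠ t j) ∧
      (∀ i j, i ≤ j → ‖divDiff f (s i) (t j) - a‖ < η) ∧
      (∀ i j, j < i → ‖divDiff f (s i) (t j) - b‖ < η) := by
  have hball : ∀ c : ℂ, Metric.ball c η ∈ 𝓝 c := fun c => Metric.ball_mem_nhds c hη
  have hUx : U ∈ 𝓝[≠] x := mem_nhdsWithin_of_mem_nhds hU
  have hne : ∀ᶠ t in 𝓝[≠] x, t ≠ x := eventually_mem_nhdsWithin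
  -- all points near `x` are good second arguments for a fixed first one
  have hnext : ∀ {u : ℝ} {c : ℂ}, u ≠ x → ‖divDiff f u x - c‖ < η →
      ∀ᶠ t in 𝓝[≠] x, ‖divDiff f u t - c‖ < η ∧ u ≠ t := by
    intro u c hu huc
    have h1 := ((tendsto_divDiff hf hu).sub_const c).norm.eventually (gt_mem_nhds huc)
    have h2 : ∀ᶠ t in 𝓝 x, u ≠ t := by
      filter_upwards [isOpen_ne.mem_nhds (Ne.symm hu)] with t ht using Ne.symm ht
    exact (h1.and h2).filter_mono nhdsWithin_le_nhds
  have hfreq : ∀ {c : ℂ}, MapClusterPt c (𝓝[≠] x) (fun t => divDiff f t x) →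
      ∃ᶠ t in 𝓝[≠] x, ‖divDiff f t x - c‖ < η := fun {c} hc => by
    simpa [dist_eq_norm] using hc.frequently (hball c)
  -- the nodes are chosen in pairs `(s i, t i)`, each close to `x` compared with all earlier ones
  obtain ⟨p, hp, hpr⟩ := exists_seq_of_forall_finset_exists
    (fun p : ℝ × ℝ => (p.1 ∈ U ∧ p.1 ≠ x ∧ ‖divDiff f p.1 x - a‖ < η) ∧
      (p.2 ∈ U ∧ p.2 ≠ x ∧ ‖divDiff f p.2 x - b‖ < η) ∧
      ‖divDiff f p.1 p.2 - a‖ < η ∧ p.1 ≠ p.2)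
    (fun p p' => (‖divDiff f p.1 p'.2 - a‖ < η ∧ p.1 ≠ p'.2) ∧
      (‖divDiff f p.2 p'.1 - b‖ < η ∧ p.2 ≠ p'.1)) (by
    intro F hF
    have e1 : ∀ᶠ t in 𝓝[≠] x, ∀ p ∈ F, ‖divDiff f p.2 t - b‖ < η ∧ p.2 ≠ t :=
      (eventually_all_finset F).2 fun p hp => hnext (hF p hp).2.1.2.1 (hF p hp).2.1.2.2
    have e2 : ∀ᶠ t in 𝓝[≠] x, ∀ p ∈ F, ‖divDiff f p.1 t - a‖ < η ∧ p.1 ≠ t :=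
      (eventually_all_finset F).2 fun p hp => hnext (hF p hp).1.2.1 (hF p hp).1.2.2
    obtain ⟨s, hs, hs1, hsU, hsx⟩ :=
      ((hfreq ha).and_eventually (e1.and ((show ∀ᶠ t in 𝓝[≠] x, t ∈ U from hUx).and hne))).exists
    obtain ⟨t, ht, ht1, ⟨ht2, hst⟩, htU, htx⟩ :=
      ((hfreq hb).and_eventually (e2.and ((hnext hsx hs).and
        ((show ∀ᶠ t in 𝓝[≠] x, t ∈ U from hUx).and hne)))).exists
    exact ⟨(s, t), ⟨⟨hsU, hsx, hs⟩, ⟨htU, htx, ht⟩, ht2, hst⟩,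
      fun p hp => ⟨ht1 p hp, hs1 p hp⟩⟩)
  have hsymm : ∀ s t, divDiff f s t = divDiff f t s := fun s t => by
    unfold divDiff
    rw [← neg_sub (f t), ← neg_sub t, Complex.ofReal_neg, neg_div_neg_eq]
  refine ⟨fun i => (p i).1, fun i => (p i).2, fun i => (hp i).1.1, fun i => (hp i).2.1.1,
    fun i j => ?_, fun i j hij => ?_, fun i j hij => ?_⟩
  · rcases lt_trichotomy i j with h | rfl | h
    · exact (hpr i j h).1.2
    · exact (hp i).2.2.2
    · exact (hpr j i h).2.2.symm
  · rcases hij.lt_or_eq with h | rfl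
    · exact (hpr i j h).1.1
    · exact (hp i).2.2.1
  · rw [hsymm]
    exact (hpr j i hij).2.1

/-! ### Triangular truncation in the Fourier basis -/

theorem sum_pow_eq_zero_of_pow_eq_one {n : ℕ} {z : ℂ} (hz : z ^ n = 1) (hz1 : z ≠ 1) :
    ∑ i : Fin n, z ^ (i : ℕ) = 0 := by
  have h := geom_sum_mul z n
  rw [hz, sub_self] at h
  rw [Fin.sum_univ_eq_sum_range (fun i => z ^ i)]
  exact (mul_eq_zero.1 h).resolve_right (sub_ne_zero.2 hz1)

theorem sum_triangular_mul {n : ℕ} {z : ℂ} (hz : z ^ n = 1) (hz1 : z ≠ 1) (hn : ‖z‖ = 1) :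
    (∑ i : Fin n, ∑ j : Fin n, star z ^ (i : ℕ) * (if i ≤ j then 1 else 0) * z ^ (j : ℕ)) *
      (1 - z) = n := by
  have hzz : star z * z = 1 := by
    have := Complex.conj_mul' z
    rw [hn] at this
    simpa using this
  have hz' : star z ^ n = 1 := by rw [← star_pow, hz, star_one]
  have hz1' : star z ≠ 1 := fun h => hz1 (by simpa using congrArg star h)
  have hrow : ∀ i : Fin n, (∑ j : Fin n, star z ^ (i : ℕ) * (if i ≤ j then 1 else 0) *
      z ^ (j : ℕ)) * (1 - z) = 1 - star z ^ (i : ℕ) := fun i => by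
    have h1 : ∑ j : Fin n, star z ^ (i : ℕ) * (if i ≤ j then 1 else 0) * z ^ (j : ℕ) =
        star z ^ (i : ℕ) * ∑ j ∈ Finset.Ico (i : ℕ) n, z ^ j := by
      have hIco : Finset.Ico (i : ℕ) n = (Finset.range n).filter fun j => (i : ℕ) ≤ j := by
        ext j; simp [and_comm]
      rw [hIco, Finset.sum_filter, Finset.mul_sum, ← Fin.sum_univ_eq_sum_range
        (fun j => star z ^ (i : ℕ) * if (i : ℕ) ≤ j then z ^ j else 0)]
      refine Finset.sum_congr rfl fun j _ => ?_
      simp only [Fin.le_def, mul_assoc, ite_mul, one_mul, zero_mul]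
    rw [h1]
    have h2 := geom_sum_Ico_mul z i.2.le
    rw [hz] at h2
    have h3 : star z ^ (i : ℕ) * z ^ (i : ℕ) = 1 := by rw [← mul_pow, hzz, one_pow]
    linear_combination (-star z ^ (i : ℕ)) * h2 + h3
  rw [Finset.sum_mul, Finset.sum_congr rfl fun i _ => hrow i, Finset.sum_sub_distrib,
    sum_pow_eq_zero_of_pow_eq_one hz' hz1']
  simp

/-- The unitary matrix of the discrete Fourier transform, whose rows are the functions `i ↦ ω ^ (k
i) / √n` with `ω = exp (2 π i / n)`. -/
noncomputable def fourierMatrix (n : ℕ) (k i : Fin n) : ℂ :=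
  (Complex.exp (2 * Real.pi * Complex.I / n) ^ (k : ℕ)) ^ (i : ℕ) / (√n : ℝ)

theorem star_fourierMatrix_mul {n : ℕ} (k k' i j : Fin n) :
    star (fourierMatrix n k i) * fourierMatrix n k' j =
      (star (Complex.exp (2 * Real.pi * Complex.I / n) ^ (k : ℕ)) ^ (i : ℕ) *
        (Complex.exp (2 * Real.pi * Complex.I / n) ^ (k' : ℕ)) ^ (j : ℕ)) / n := by
  have hs : ((√n : ℝ) : ℂ) * ((√n : ℝ) : ℂ) = n := by
    rw [← Complex.ofReal_mul, Real.mul_self_sqrt (Nat.cast_nonneg n), Complex.ofReal_natCast]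
  have hstar : star ((√n : ℝ) : ℂ) = ((√n : ℝ) : ℂ) := Complex.conj_ofReal _
  rw [fourierMatrix, fourierMatrix, star_div₀, hstar, div_mul_div_comm, hs, star_pow]

theorem fourierMatrix_orthonormal {n : ℕ} (hn : n ≠ 0) (k k' : Fin n) :
    ∑ i, star (fourierMatrix n k i) * fourierMatrix n k' i = if k = k' then 1 else 0 := by
  have hprim := Complex.isPrimitiveRoot_exp n hn
  have hn' : (n : ℂ) ≠ 0 := Nat.cast_ne_zero.2 hn
  simp only [star_fourierMatrix_mul]
  set ω := Complex.exp (2 * Real.pi * Complex.I / n)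
  have hω : star ω * ω = 1 := by
    have := Complex.conj_mul' ω
    rw [Complex.norm_eq_one_of_pow_eq_one hprim.pow_eq_one hn] at this
    simpa using this
  simp only [← mul_pow, ← Finset.sum_div]
  split_ifs with hk
  · subst hk
    rw [star_pow, ← mul_pow, hω]
    simp [hn']
  · rw [sum_pow_eq_zero_of_pow_eq_one, zero_div]
    · rw [mul_pow, ← star_pow, ← pow_mul, ← pow_mul, mul_comm (k : ℕ), mul_comm (k' : ℕ), pow_mul,
        pow_mul, hprim.pow_eq_one]
      simp
    · intro h
      apply hk
      have h2 : ω ^ (k : ℕ) * (star (ω ^ (k : ℕ)) * ω ^ (k' : ℕ)) = ω ^ (k' : ℕ) := by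
        rw [← mul_assoc, star_pow, ← mul_pow, mul_comm ω, hω, one_pow, one_mul]
      rw [h, mul_one] at h2
      exact Fin.ext (hprim.pow_inj k.2 k'.2 h2)

/-- The diagonal entries, in the Fourier basis, of a matrix close to a constant plus a multiple of
the triangular truncation. The constant part drops out for nonzero frequencies, and the triangular
part contributes `(a - b) / (1 - z)` with `‖1 - z‖ ≤ 2 π k / n`. -/
theorem le_norm_fourier {n : ℕ} {M : Fin n → Fin n → ℂ} {a b : ℂ}
    (hM : ∀ i j, ‖M i j - (b + (a - b) * (if i ≤ j then 1 else 0))‖ ≤ 1 / n) (k : Fin n)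
    (hk : (k : ℕ) ≠ 0) :
    ‖a - b‖ / (2 * Real.pi) * (1 / k) * n - 1 ≤
      ‖∑ i, ∑ j, star (fourierMatrix n k i) * M i j * fourierMatrix n k j‖ := by
  have hn : n ≠ 0 := k.pos.ne'
  have hn0 : (0 : ℝ) < n := by exact_mod_cast Nat.pos_of_ne_zero hn
  have hk0 : (0 : ℝ) < (k : ℕ) := by exact_mod_cast Nat.pos_of_ne_zero hk
  have hprim := Complex.isPrimitiveRoot_exp n hn
  have hn' : (n : ℂ) ≠ 0 := Nat.cast_ne_zero.2 hn
  set z : ℂ := Complex.exp (2 * Real.pi * Complex.I / n) ^ (k : ℕ) with hz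
  have hzn : z ^ n = 1 := by
    rw [hz, ← pow_mul, mul_comm (k : ℕ) n, pow_mul, hprim.pow_eq_one, one_pow]
  have hz1 : z ≠ 1 := hprim.pow_ne_one_of_pos_of_lt hk k.2
  have hznorm : ‖z‖ = 1 := Complex.norm_eq_one_of_pow_eq_one hzn hn
  have h1z : (1 : ℂ) - z ≠ 0 := sub_ne_zero.2 hz1.symm
  have h1zn : ‖1 - z‖ ≤ 2 * Real.pi * k / n := by
    have : z = Complex.exp (Complex.I * ((2 * Real.pi * k / n : ℝ) : ℂ)) := by
      rw [hz, ← Complex.exp_nat_mul]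
      congr 1
      push_cast
      ring
    rw [norm_sub_rev, this]
    refine Real.norm_exp_I_mul_ofReal_sub_one_le.trans (le_of_eq ?_)
    rw [Real.norm_of_nonneg (by positivity)]
  set E : Fin n → Fin n → ℂ := fun i j => M i j - (b + (a - b) * (if i ≤ j then 1 else 0)) with hE
  have hsum : ∑ i, ∑ j, star (fourierMatrix n k i) * M i j * fourierMatrix n k j =
      (a - b) / (1 - z) +
        (∑ i : Fin n, ∑ j : Fin n, star z ^ (i : ℕ) * E i j * z ^ (j : ℕ)) / n := by
    have hT := sum_triangular_mul hzn hz1 hznorm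
    have h0 : ∑ i : Fin n, ∑ j : Fin n, star z ^ (i : ℕ) * z ^ (j : ℕ) = 0 := by
      simp only [← Finset.mul_sum, sum_pow_eq_zero_of_pow_eq_one hzn hz1]
      simp
    have hterm : ∀ i j, star (fourierMatrix n k i) * M i j * fourierMatrix n k j =
        (b * (star z ^ (i : ℕ) * z ^ (j : ℕ)) +
          (a - b) * (star z ^ (i : ℕ) * (if i ≤ j then 1 else 0) * z ^ (j : ℕ)) +
          star z ^ (i : ℕ) * E i j * z ^ (j : ℕ)) / n := fun i j => by
      rw [mul_right_comm, star_fourierMatrix_mul, hE]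
      ring
    have hpull : ∀ (c : ℂ) (g : Fin n → Fin n → ℂ), ∑ i, ∑ j, c * g i j = c * ∑ i, ∑ j, g i j :=
      fun c g => by simp only [Finset.mul_sum]
    simp only [hterm, ← Finset.sum_div, Finset.sum_add_distrib]
    rw [hpull, hpull, h0, eq_div_of_mul_eq h1z hT]
    field_simp
    ring
  have hEsum : ‖(∑ i : Fin n, ∑ j : Fin n, star z ^ (i : ℕ) * E i j * z ^ (j : ℕ)) / n‖ ≤ 1 := by
    rw [norm_div, Complex.norm_natCast, div_le_one hn0]
    calc _ ≤ ∑ i : Fin n, ∑ j : Fin n, (1 / n : ℝ) := by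
          refine (norm_sum_le _ _).trans (Finset.sum_le_sum fun i _ => ?_)
          refine (norm_sum_le _ _).trans (Finset.sum_le_sum fun j _ => ?_)
          rw [norm_mul, norm_mul, norm_pow, norm_pow, norm_star, hznorm, one_pow, one_pow, one_mul,
            mul_one]
          exact hM i j
      _ = n := by
          simp only [Finset.sum_const, Finset.card_univ, Fintype.card_fin, nsmul_eq_mul]
          field_simp
  have hmain : ‖a - b‖ / (2 * Real.pi) * (1 / k) * n ≤ ‖(a - b) / (1 - z)‖ := by
    rw [norm_div, le_div_iff₀ (norm_pos_iff.2 h1z)]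
    calc _ ≤ ‖a - b‖ / (2 * Real.pi) * (1 / k) * n * (2 * Real.pi * k / n) := by gcongr
      _ = ‖a - b‖ := by field_simp
  rw [hsum]
  have := norm_sub_le_norm_add ((a - b) / (1 - z))
    ((∑ i : Fin n, ∑ j : Fin n, star z ^ (i : ℕ) * E i j * z ^ (j : ℕ)) / n)
  linarith

/-- Summing over the frequencies produces a harmonic sum: the triangular truncation of the matrix of
ones, whose trace norm is `n`, has trace norm of order `n log n`. -/
theorem le_sum_norm_fourier {n : ℕ} {M : Fin (n + 1) → Fin (n + 1) → ℂ} {a b : ℂ}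
    (hM : ∀ i j, ‖M i j - (b + (a - b) * (if i ≤ j then 1 else 0))‖ ≤ 1 / (n + 1 : ℕ)) :
    (‖a - b‖ / (2 * Real.pi) * (∑ k ∈ Finset.range n, 1 / ((k : ℝ) + 1)) - 1) * (n + 1 : ℕ) ≤
      ∑ k, ‖∑ i, ∑ j, star (fourierMatrix (n + 1) k i) * M i j * fourierMatrix (n + 1) k j‖ := by
  rw [Fin.sum_univ_succ]
  have h := Finset.sum_le_sum fun (k : Fin n) (_ : k ∈ Finset.univ) =>
    le_norm_fourier hM k.succ (by simp)
  refine le_trans ?_ (le_add_of_nonneg_of_le (norm_nonneg _) h)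
  rw [Finset.sum_sub_distrib, ← Finset.sum_mul, ← Finset.mul_sum,
    ← Fin.sum_univ_eq_sum_range (fun k => 1 / ((k : ℝ) + 1))]
  simp only [Fin.val_succ, Nat.cast_add, Nat.cast_one, Finset.sum_const, Finset.card_univ,
    Fintype.card_fin, nsmul_eq_mul]
  linarith

/-- Near a point where `f` is not differentiable, multiplication by the divided differences of `f`
increases the trace norm of an all-ones matrix (which is `n`) by an arbitrarily large factor `Λ`, as
is seen on the diagonal in a suitable orthonormal basis `φ`. If the difference quotients are
unbounded, a one by one matrix suffices. -/
theorem exists_nodes_of_not_differentiableAt {f : ℝ → ℂ} (hf : Continuous f) {x : ℝ}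
    (hx : ¬ DifferentiableAt ℝ f x) {U : Set ℝ} (hU : U ∈ 𝓝 x) (Λ : ℝ) :
    ∃ (n : ℕ) (s t : Fin n → ℝ) (φ : Fin n → Fin n → ℂ), n ≠ 0 ∧ (∀ i, s i ∈ U) ∧
      (∀ i, t i ∈ U) ∧ (∀ i j, s i ≠ t j) ∧
      (∀ k k', ∑ i, star (φ k i) * φ k' i = if k = k' then 1 else 0) ∧
      Λ * n ≤ ∑ k, ‖∑ i, ∑ j, star (φ k i) * divDiff f (s i) (t j) * φ k j‖ := by
  by_cases hb : ∃ C : ℝ, ∀ᶠ t in 𝓝[≠] x, ‖divDiff f t x‖ ≤ C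
  · obtain ⟨C, hC⟩ := hb
    have hq : ¬ ∃ a, Tendsto (fun t => divDiff f t x) (𝓝[≠] x) (𝓝 a) := by
      rintro ⟨a, ha⟩
      refine hx (HasDerivAt.differentiableAt (f' := a) ?_)
      rw [hasDerivAt_iff_tendsto_slope]
      refine ha.congr fun t => ?_
      rw [slope_def_module, divDiff, div_eq_inv_mul, ← Complex.ofReal_inv, ← Complex.real_smul]
    obtain ⟨a, b, hab, ha, hb⟩ := exists_two_mapClusterPt hC hq
    have hpos : 0 < ‖a - b‖ / (2 * Real.pi) :=
      div_pos (norm_pos_iff.2 (sub_ne_zero.2 hab)) (by positivity)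
    obtain ⟨n, hn⟩ := ((Real.tendsto_sum_range_one_div_nat_succ_atTop.const_mul_atTop
      hpos).eventually_ge_atTop (Λ + 1)).exists
    -- with this tolerance all the errors together contribute at most `1` to each Fourier entry
    obtain ⟨s, t, hs, ht, hst, hsa, hsb⟩ := exists_lacunary_nodes hf ha hb hU
      (η := 1 / ((n + 1 : ℕ) : ℝ)) (by positivity)
    refine ⟨n + 1, fun i => s i, fun i => t i, fourierMatrix (n + 1), n.succ_ne_zero,
      fun i => hs i, fun i => ht i, fun i j => hst i j,
      fourierMatrix_orthonormal n.succ_ne_zero, ?_⟩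
    refine le_trans ?_ (le_sum_norm_fourier (a := a) (b := b) fun i j => ?_)
    · gcongr
      linarith
    · split_ifs with hij
      · simpa using (hsa i j hij).le
      · simpa using (hsb i j (not_le.1 hij)).le
  · push Not at hb
    obtain ⟨h, hh, hhU, hne⟩ := ((hb Λ).and_eventually
      ((show ∀ᶠ t in 𝓝[≠] x, t ∈ U from mem_nhdsWithin_of_mem_nhds hU).and
        (eventually_mem_nhdsWithin))).exists
    refine ⟨1, fun _ => h, fun _ => x, fun _ _ => 1, one_ne_zero, fun _ => hhU,
      fun _ => mem_of_mem_nhds hU, fun _ _ => hne, fun k k' => ?_, ?_⟩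
    · simp [Subsingleton.elim k k']
    · simpa using hh.le

/-! ### Diagonal operators and cross operators -/

/-- The self-adjoint operator `∑ w i j (|e i⟩⟨e' j| + |e' j⟩⟨e i|)`. For orthonormal families `e`
and `e'` orthogonal to each other it maps the span of either one into the span of the other. -/
noncomputable def crossOperator {H : Type*} [NormedAddCommGroup H]
    [InnerProductSpace ℂ H] {n : ℕ} (e e' : Fin n → H) (w : Fin n → Fin n → ℝ) : H →L[ℂ] H :=
  ∑ i, ∑ j, (w i j : ℂ) • (rankOne ℂ (e i) (e' j) + rankOne ℂ (e' j) (e i))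

theorem crossOperator_apply {H : Type*} [NormedAddCommGroup H] [InnerProductSpace ℂ H] {n : ℕ}
    (e e' : Fin n → H) (w : Fin n → Fin n → ℝ) (x : H) :
    crossOperator e e' w x =
      ∑ i, ∑ j, (w i j : ℂ) • (⟪e' j, x⟫_ℂ • e i + ⟪e i, x⟫_ℂ • e' j) := by
  simp [crossOperator, sum_apply]

theorem exists_orthonormal_of_countable (hH : ¬ FiniteDimensional ℂ H) (J : Type*)
    [Countable J] : ∃ v : J → H, Orthonormal ℂ v := by
  obtain ⟨w, e, -⟩ := exists_hilbertBasis ℂ H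
  have hw : Infinite w := by
    by_contra hfin
    rw [not_infinite_iff_finite] at hfin
    have := Fintype.ofFinite w
    exact hH (Module.Finite.of_basis e.toOrthonormalBasis.toBasis)
  obtain ⟨j, hj⟩ := exists_injective_nat J
  exact ⟨_, e.orthonormal.comp (fun x => Infinite.natEmbedding w (j x))
    ((Infinite.natEmbedding w).injective.comp hj)⟩

/-- The operator is the norm-convergent series of the rank one operators `l j • |v j⟩⟨v j|`. -/
theorem exists_diagonal_operator {J : Type*} {v : J → H} (hv : Orthonormal ℂ v) {l : J → ℝ}
    (hl : Tendsto l cofinite (𝓝 0)) :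
    ∃ A : H →L[ℂ] H, IsSelfAdjoint A ∧ IsCompactOperator A ∧ ∀ j, A (v j) = (l j : ℂ) • v j := by
  classical
  set T : J → H →L[ℂ] H := fun j => (l j : ℂ) • rankOne ℂ (v j) (v j) with hT
  have hTsa : ∀ j, IsSelfAdjoint (T j) := fun j => by
    rw [IsSelfAdjoint, hT, star_smul, ContinuousLinearMap.star_eq_adjoint, adjoint_rankOne]
    congr 1
    exact Complex.conj_ofReal _
  have hsum : Summable T := by
    refine summable_of_isSelfAdjoint_of_mul_eq_zero hTsa (fun i j hij => ?_) ?_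
    · ext x
      simp [hT, hv.2 hij]
    · have : ∀ j, ‖T j‖ = ‖l j‖ := fun j => by
        simp [hT, norm_smul, hv.1 j]
      simpa only [this, norm_zero] using hl.norm
  obtain ⟨A, hA⟩ := hsum
  refine ⟨A, ?_, ?_, fun j => ?_⟩
  · have h1 := hA.star
    simp only [fun j => (hTsa j).star_eq] at h1
    exact h1.unique hA
  · have hTc : ∀ j, IsCompactOperator (T j) := fun j =>
      ((isCompactOperator_of_locallyCompactSpace_dom (innerSL ℂ (v j))).clm_comp
        (ContinuousLinearMap.toSpanSingleton ℂ (v j))).smul (l j : ℂ)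
    refine isCompactOperator_of_tendsto hA (Eventually.of_forall fun F => ?_)
    induction F using Finset.induction_on with
    | empty => simpa using isCompactOperator_zero
    | insert a F ha ih => rw [Finset.sum_insert ha]; exact (hTc a).add ih
  · have h1 := hA.mapL (ContinuousLinearMap.apply ℂ H (v j))
    refine h1.unique ?_
    convert hasSum_single j fun i hij => ?_ using 1
    · simp [hT, hv.1 j]
    · simp [hT, hv.2 hij]

theorem isSelfAdjoint_crossOperator {n : ℕ} (e e' : Fin n → H) (w : Fin n → Fin n → ℝ) :
    IsSelfAdjoint (crossOperator e e' w) := by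
  rw [IsSelfAdjoint, crossOperator, star_sum]
  refine Finset.sum_congr rfl fun i _ => ?_
  rw [star_sum]
  refine Finset.sum_congr rfl fun j _ => ?_
  rw [star_smul, star_add, ContinuousLinearMap.star_eq_adjoint,
    ContinuousLinearMap.star_eq_adjoint, adjoint_rankOne, adjoint_rankOne, add_comm]
  congr 1
  exact Complex.conj_ofReal _

theorem norm_crossOperator_le {n : ℕ} {e e' : Fin n → H} (he : ∀ i, ‖e i‖ = 1)
    (he' : ∀ i, ‖e' i‖ = 1) (w : Fin n → Fin n → ℝ) :
    ‖crossOperator e e' w‖ ≤ ∑ i, ∑ j, |w i j| * 2 := by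
  refine (norm_sum_le _ _).trans (Finset.sum_le_sum fun i _ => ?_)
  refine (norm_sum_le _ _).trans (Finset.sum_le_sum fun j _ => ?_)
  rw [norm_smul, Complex.norm_real, Real.norm_eq_abs]
  gcongr
  refine (norm_add_le _ _).trans ?_
  simp only [norm_rankOne, he, he']
  norm_num

/-- If the weights are `w i j = c / (s i - t j)`, the commutator with `A` has the entry `± c` in
each position between the two families, hence has rank at most two. -/
theorem crossOperator_commutator {n : ℕ} {e e' : Fin n → H} {w : Fin n → Fin n → ℝ}
    {A : H →L[ℂ] H} (hA : IsSelfAdjoint A) {s t : Fin n → ℝ} {c : ℝ}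
    (hs : ∀ i, A (e i) = (s i : ℂ) • e i) (ht : ∀ i, A (e' i) = (t i : ℂ) • e' i)
    (hw : ∀ i j, w i j * (s i - t j) = c) :
    A * crossOperator e e' w - crossOperator e e' w * A =
      rankOne ℂ ((c : ℂ) • ∑ i, e i) (∑ j, e' j) + rankOne ℂ (-(c : ℂ) • ∑ j, e' j) (∑ i, e i) := by
  have hAin : ∀ {y : H} {μ : ℝ} (x : H), A y = (μ : ℂ) • y → ⟪y, A x⟫_ℂ = μ * ⟪y, x⟫_ℂ :=
    fun {y μ} x hy => by
      rw [← ContinuousLinearMap.adjoint_inner_left, ← ContinuousLinearMap.star_eq_adjoint,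
        hA.star_eq, hy, inner_smul_left, Complex.conj_ofReal]
  set p := ∑ i, e i with hp
  set q := ∑ j, e' j with hq
  have hwc : ∀ i j, (w i j : ℂ) * (s i - t j) = c := fun i j => by exact_mod_cast hw i j
  ext x
  change _ = ⟪q, x⟫_ℂ • (c : ℂ) • p + ⟪p, x⟫_ℂ • (-(c : ℂ)) • q
  simp only [sub_apply, mul_apply_eq_comp, crossOperator_apply, map_sum,
    map_smul, map_add, hs, ht, hAin x (hs _), hAin x (ht _), ← Finset.sum_sub_distrib]
  have hterm : ∀ i j,
      (w i j : ℂ) • (⟪e' j, x⟫_ℂ • (s i : ℂ) • e i + ⟪e i, x⟫_ℂ • (t j : ℂ) • e' j) -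
      (w i j : ℂ) • ((t j * ⟪e' j, x⟫_ℂ) • e i + (s i * ⟪e i, x⟫_ℂ) • e' j) =
      ⟪e' j, x⟫_ℂ • (c : ℂ) • e i + ⟪e i, x⟫_ℂ • (-(c : ℂ)) • e' j := fun i j => by
    rw [← hwc i j]
    module
  simp only [hterm, Finset.sum_add_distrib, ← Finset.smul_sum, ← Finset.sum_smul]
  simp only [← sum_inner, ← hp, ← hq]

/-- The entries of `F * L - L * F` between eigenvectors of `F`: the weights of `L` get multiplied by
the differences of the eigenvalues. -/
theorem inner_sum_commutator {H : Type*} [NormedAddCommGroup H] [InnerProductSpace ℂ H]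
    {n : ℕ} {e e' : Fin n → H} (he : Orthonormal ℂ e)
    {F L : H →L[ℂ] H} {α β : Fin n → ℂ} {w : Fin n → Fin n → ℂ}
    (hα : ∀ i, F (e i) = α i • e i) (hβ : ∀ j, F (e' j) = β j • e' j)
    (hL : ∀ j, L (e' j) = ∑ i, w i j • e i) (φ ψ : Fin n → ℂ) :
    ⟪∑ i, φ i • e i, (F * L - L * F) (∑ j, ψ j • e' j)⟫_ℂ =
      ∑ i, ∑ j, star (φ i) * ((α i - β j) * w i j) * ψ j := by
  have h1 : (F * L - L * F) (∑ j, ψ j • e' j) =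
      ∑ i, (∑ j, (α i - β j) * w i j * ψ j) • e i := by
    simp only [sub_apply, mul_apply_eq_comp, map_sum, map_smul, hL, hβ, hα, Finset.smul_sum,
      Finset.sum_smul, ← Finset.sum_sub_distrib]
    rw [Finset.sum_comm]
    refine Finset.sum_congr rfl fun i _ => Finset.sum_congr rfl fun j _ => ?_
    module
  rw [h1, he.inner_sum]
  refine Finset.sum_congr rfl fun i _ => ?_
  rw [Finset.mul_sum]
  refine Finset.sum_congr rfl fun j _ => ?_
  rw [starRingEnd_apply]
  ring

theorem orthonormal_sum_smul {H C : Type*} [NormedAddCommGroup H] [InnerProductSpace ℂ H]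
    {n : ℕ} {e : C × Fin n → H} (he : Orthonormal ℂ e)
    {φ : Fin n → Fin n → ℂ}
    (hφ : ∀ k k', ∑ i, star (φ k i) * φ k' i = if k = k' then 1 else 0) :
    Orthonormal ℂ fun p : C × Fin n => ∑ i, φ p.2 i • e (p.1, i) := by
  classical
  rw [orthonormal_iff_ite] at he ⊢
  rintro ⟨c, k⟩ ⟨c', k'⟩
  simp only [sum_inner, inner_sum, inner_smul_left, inner_smul_right, he, Prod.mk.injEq]
  by_cases hc : c = c'
  · simp [hc, ← hφ k k', mul_comm]
  · simp [hc]

/-! ### Assembling the blocks -/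

theorem exists_nat_mul_mem_Icc {x y : ℝ} (hy : 0 < y) (hyx : y ≤ x) :
    ∃ m : ℕ, x ≤ m * y ∧ m * y ≤ 2 * x := by
  refine ⟨⌈x / y⌉₊, (div_le_iff₀ hy).1 (Nat.le_ceil _), ?_⟩
  have h := Nat.ceil_lt_add_one (div_nonneg (hy.le.trans hyx) hy.le)
  calc _ ≤ (x / y + 1) * y := by gcongr
    _ = x + y := by field_simp
    _ ≤ 2 * x := by linarith

theorem exists_small_weight {n : ℕ} (hn : n ≠ 0) (d : Fin n → Fin n → ℝ) {α β : ℝ} (hα : 0 < α)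
    (hβ : 0 < β) : ∃ c : ℝ, 0 < c ∧ ∑ i, ∑ j, |c / d i j| * 2 ≤ α ∧ n * c ≤ β := by
  set S : ℝ := ∑ i, ∑ j, |1 / d i j| * 2 with hS
  have hS0 : 0 ≤ S := by positivity
  have hn0 : (0 : ℝ) < n := by exact_mod_cast Nat.pos_of_ne_zero hn
  set c := min (α / (S + 1)) (β / n) with hc
  have hc0 : 0 < c := lt_min (by positivity) (by positivity)
  refine ⟨c, hc0, ?_, ?_⟩
  · have : ∑ i, ∑ j, |c / d i j| * 2 = c * S := by
      simp only [hS, Finset.mul_sum]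
      refine Finset.sum_congr rfl fun i _ => Finset.sum_congr rfl fun j _ => ?_
      rw [div_eq_mul_one_div, abs_mul, abs_of_pos hc0, mul_assoc]
    rw [this]
    calc c * S ≤ α / (S + 1) * (S + 1) := by
          gcongr
          · exact min_le_left _ _
          · linarith
      _ = α := by field_simp
  · calc n * c ≤ n * (β / n) := by gcongr; exact min_le_right _ _
      _ = β := by field_simp

theorem Orthonormal.norm_sum_eq_sqrt {H : Type*} [NormedAddCommGroup H] [InnerProductSpace ℂ H]
    {k : ℕ} {u : Fin k → H} (hu : Orthonormal ℂ u) : ‖∑ i, u i‖ = √k := by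
  have h := hu.inner_sum (fun _ => 1) (fun _ => 1) Finset.univ
  simp only [one_smul, inner_self_eq_norm_sq_to_K] at h
  simp only [Complex.coe_algebraMap, map_one, mul_one, Finset.sum_const, Finset.card_univ,
    Fintype.card_fin, nsmul_eq_mul] at h
  rw [← Real.sqrt_sq (norm_nonneg (∑ i, u i))]
  congr 1
  exact_mod_cast h

/-- The block operators of the construction, given nodes `s r`, `t r` and weights `c r` for
countably many blocks `r`: `A` is diagonal with the nodes as eigenvalues, `L` is the orthogonal sum
of cross operators with entries `c r / (s r i - t r j)`, and the trace norms `2 * n r * c r` of the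
blocks of `A * L - L * A` are summable. -/
theorem exists_diagonal_and_cross_operator (hH : ¬ FiniteDimensional ℂ H) {R : Type*} [Countable R]
    {n : R → ℕ} {s t : ∀ r, Fin (n r) → ℝ} {c δ : R → ℝ} (hc : ∀ r, 0 ≤ c r)
    (hst : ∀ r i j, s r i ≠ t r j) (hδ : Tendsto δ cofinite (𝓝 0)) (hs : ∀ r i, |s r i| ≤ δ r)
    (ht : ∀ r i, |t r i| ≤ δ r) (hw : ∀ r, ∑ i, ∑ j, |c r / (s r i - t r j)| * 2 ≤ δ r)
    (hsum : Summable fun r => n r * c r) :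
    ∃ (A L : H →L[ℂ] H) (v : (Σ r, Fin (n r) ⊕ Fin (n r)) → H), Orthonormal ℂ v ∧
      IsSelfAdjoint A ∧ IsCompactOperator A ∧ IsSelfAdjoint L ∧
      HasBoundedDiagonals (A * L - L * A) ∧
      (∀ r i, A (v ⟨r, Sum.inl i⟩) = (s r i : ℂ) • v ⟨r, Sum.inl i⟩) ∧
      (∀ r i, A (v ⟨r, Sum.inr i⟩) = (t r i : ℂ) • v ⟨r, Sum.inr i⟩) ∧
      ∀ r j, L (v ⟨r, Sum.inr j⟩) =
        ∑ i, ((c r / (s r i - t r j) : ℝ) : ℂ) • v ⟨r, Sum.inl i⟩ := by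
  classical
  obtain ⟨v, hv⟩ := exists_orthonormal_of_countable hH (Σ r, Fin (n r) ⊕ Fin (n r))
  have hfst : Tendsto (Sigma.fst : (Σ r, Fin (n r) ⊕ Fin (n r)) → R) cofinite cofinite :=
    Tendsto.cofinite_of_finite_preimage_singleton fun r =>
      (Set.finite_range (Sigma.mk r)).subset (by rintro ⟨r', i⟩ rfl; exact ⟨i, rfl⟩)
  have hl : Tendsto (fun j : Σ r, Fin (n r) ⊕ Fin (n r) => Sum.elim (s j.1) (t j.1) j.2) cofinite
      (𝓝 0) := by
    refine squeeze_zero_norm (a := δ ∘ Sigma.fst) ?_ (hδ.comp hfst)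
    rintro ⟨r, i | i⟩
    · exact hs r i
    · exact ht r i
  obtain ⟨A, hA, hAc, hAv⟩ := exists_diagonal_operator hv hl
  set e : ∀ r : R, Fin (n r) → H := fun r i => v ⟨r, Sum.inl i⟩ with he
  set e' : ∀ r : R, Fin (n r) → H := fun r i => v ⟨r, Sum.inr i⟩ with he'
  have hAe : ∀ r i, A (e r i) = (s r i : ℂ) • e r i := fun r i => hAv ⟨r, Sum.inl i⟩
  have hAe' : ∀ r i, A (e' r i) = (t r i : ℂ) • e' r i := fun r i => hAv ⟨r, Sum.inr i⟩
  have heo : ∀ r, Orthonormal ℂ (e r) := fun r =>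
    hv.comp (fun i => ⟨r, Sum.inl i⟩) fun i j h => by simpa using h
  have heo' : ∀ r, Orthonormal ℂ (e' r) := fun r =>
    hv.comp (fun i => ⟨r, Sum.inr i⟩) fun i j h => by simpa using h
  set w : ∀ r, Fin (n r) → Fin (n r) → ℝ := fun r i j => c r / (s r i - t r j) with hwdef
  set T : R → H →L[ℂ] H := fun r => crossOperator (e r) (e' r) (w r) with hT
  have hTsa : ∀ r, IsSelfAdjoint (T r) := fun r => isSelfAdjoint_crossOperator _ _ _
  have hT0 : ∀ r r' i, r ≠ r' → T r (v ⟨r', i⟩) = 0 := fun r r' i hrr => by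
    have h : ∀ k, ⟪v ⟨r, k⟩, v ⟨r', i⟩⟫_ℂ = 0 := fun k =>
      hv.2 fun h => hrr (congrArg Sigma.fst h)
    simp [hT, crossOperator_apply, he, he', h]
  obtain ⟨L, hL⟩ : Summable T := by
    refine summable_of_isSelfAdjoint_of_mul_eq_zero hTsa (fun r r' hrr => ?_)
      (squeeze_zero (fun r => norm_nonneg _) (fun r => ?_) hδ)
    · ext x
      rw [mul_apply_eq_comp, show T r' x = _ from crossOperator_apply _ _ _ x]
      simp [he, he', hT0 r r' _ hrr]
    · exact (norm_crossOperator_le (fun i => hv.1 _) (fun i => hv.1 _) _).trans (hw r)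
  refine ⟨A, L, v, hv, hA, hAc, ?_, ?_, hAe, hAe', fun r j => ?_⟩
  · have h1 := hL.star
    simp only [(hTsa _).star_eq] at h1
    exact h1.unique hL
  · have hcomm : HasSum (fun r => A * T r - T r * A) (A * L - L * A) :=
      (hL.mul_left A).sub (hL.mul_right A)
    have hD : ∀ r, DiagonalSumBound (A * T r - T r * A) (2 * (n r * c r)) := fun r => by
      have hwc : ∀ i j, w r i j * (s r i - t r j) = c r := fun i j =>
        div_mul_cancel₀ _ (sub_ne_zero.2 (hst r i j))
      rw [crossOperator_commutator hA (hAe r) (hAe' r) hwc]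
      have h := (DiagonalSumBound.rankOne ((c r : ℂ) • ∑ i, e r i) (∑ j, e' r j)).add
        (DiagonalSumBound.rankOne (-(c r : ℂ) • ∑ j, e' r j) (∑ i, e r i))
      rw [norm_smul, norm_smul, norm_neg, (heo r).norm_sum_eq_sqrt, (heo' r).norm_sum_eq_sqrt,
        Complex.norm_real, Real.norm_of_nonneg (hc r), mul_assoc,
        Real.mul_self_sqrt (Nat.cast_nonneg _), ← two_mul, mul_comm (c r)] at h
      exact h
    exact ⟨_, tsum_nonneg fun r => by have := hc r; positivity,
      DiagonalSumBound.hasSum hD hcomm (hsum.mul_left 2).hasSum⟩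
  · have h1 := hL.mapL (ContinuousLinearMap.apply ℂ H (e' r j))
    have h2 := hasSum_single (f := fun r' => T r' (e' r j)) r fun r' hr' => hT0 r' r _ hr'
    rw [show L (v ⟨r, Sum.inr j⟩) = T r (e' r j) from h1.unique h2,
      show T r (e' r j) = _ from crossOperator_apply _ _ _ _]
    refine Finset.sum_congr rfl fun i _ => ?_
    have hee0 : ⟪e r i, e' r j⟫_ℂ = 0 := hv.2 (by simp)
    change _ = (w r i j : ℂ) • e r i
    simp [orthonormal_iff_ite.1 (heo' r), hee0]

/-- Nodes as provided near points of non-differentiability accumulating at `0` contradict the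
hypothesis. The block of level `b` is repeated `m b` times with a tiny weight `c b`, chosen so that
`m b * n b * c b` lies between `2⁻ᵇ` and `2 * 2⁻ᵇ`. Then `A * L - L * A` is of trace class, while
level `b` alone contributes at least `4 ^ b * 2⁻ᵇ` to the diagonal sums of `f(A) * L - L * f(A)`. -/
theorem CompactRespectsTraceClass.false_of_nodes (hH : ¬ FiniteDimensional ℂ H) {f : ℝ → ℂ}
    (hf : Continuous f) (ha : CompactRespectsTraceClass H f)
    (hnodes : ∀ b : ℕ, ∃ (n : ℕ) (s t : Fin n → ℝ) (φ : Fin n → Fin n → ℂ), n ≠ 0 ∧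
      (∀ i, |s i| ≤ 1 / ((b : ℝ) + 1)) ∧ (∀ i, |t i| ≤ 1 / ((b : ℝ) + 1)) ∧
      (∀ i j, s i ≠ t j) ∧
      (∀ k k', ∑ i, star (φ k i) * φ k' i = if k = k' then 1 else 0) ∧
      4 ^ b * (n : ℝ) ≤ ∑ k, ‖∑ i, ∑ j, star (φ k i) * divDiff f (s i) (t j) * φ k j‖) :
    False := by
  choose n s t φ hn hs ht hst hφ hlarge using hnodes
  have hc : ∀ b, ∃ c : ℝ, 0 < c ∧ (∑ i, ∑ j, |c / (s b i - t b j)| * 2 ≤ 1 / ((b : ℝ) + 1)) ∧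
      n b * c ≤ (1 / 2) ^ b := fun b =>
    exists_small_weight (hn b) (fun i j => s b i - t b j) (by positivity) (by positivity)
  choose c hc0 hcnorm hcn using hc
  have hm : ∀ b, ∃ m : ℕ, (1 / 2 : ℝ) ^ b ≤ m * (n b * c b) ∧ m * (n b * c b) ≤ 2 * (1 / 2) ^ b :=
    fun b => exists_nat_mul_mem_Icc
      (mul_pos (by exact_mod_cast Nat.pos_of_ne_zero (hn b)) (hc0 b)) (hcn b)
  choose m hm1 hm2 using hm
  have hfst : Tendsto (Sigma.fst : (Σ b, Fin (m b)) → ℕ) cofinite atTop := by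
    rw [← Nat.cofinite_eq_atTop]
    exact Tendsto.cofinite_of_finite_preimage_singleton fun b =>
      (Set.finite_range (Sigma.mk b)).subset (by rintro ⟨b', i⟩ rfl; exact ⟨i, rfl⟩)
  have hsum : Summable fun r : Σ b, Fin (m b) => n r.1 * c r.1 := by
    refine (summable_sigma_of_nonneg fun r => by have := hc0 r.1; positivity).2
      ⟨fun b => Summable.of_finite, ?_⟩
    refine Summable.of_nonneg_of_le (fun b => tsum_nonneg fun _ => by have := hc0 b; positivity)
      (fun b => ?_) (summable_geometric_two.mul_left 2)
    rw [tsum_fintype]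
    simpa using hm2 b
  obtain ⟨A, L, v, hv, hA, hAc, hLsa, hAL, hAe, hAe', hLe'⟩ :=
    exists_diagonal_and_cross_operator hH (R := Σ b, Fin (m b)) (n := fun r => n r.1)
      (s := fun r => s r.1) (t := fun r => t r.1) (c := fun r => c r.1)
      (fun r => (hc0 r.1).le) (fun r => hst r.1)
      (tendsto_one_div_add_atTop_nhds_zero_nat.comp hfst) (fun r => hs r.1) (fun r => ht r.1)
      (fun r => hcnorm r.1) hsum
  obtain ⟨C, hC⟩ := (ha.hasBoundedDiagonals_commutator hf hA hAc hLsa hAL).exists_sum_le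
  -- only the `m b` copies of the block of level `b` are tested
  have hlow : ∀ b : ℕ, (2 : ℝ) ^ b ≤ C := fun b => by
    have hE : Orthonormal ℂ fun q : Fin (m b) × Fin (n b) => v ⟨⟨b, q.1⟩, Sum.inl q.2⟩ :=
      hv.comp (fun q : Fin (m b) × Fin (n b) => ⟨⟨b, q.1⟩, Sum.inl q.2⟩) (by
        rintro ⟨c, i⟩ ⟨c', i'⟩ h
        cases h
        rfl)
    have hE' : Orthonormal ℂ fun q : Fin (m b) × Fin (n b) => v ⟨⟨b, q.1⟩, Sum.inr q.2⟩ :=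
      hv.comp (fun q : Fin (m b) × Fin (n b) => ⟨⟨b, q.1⟩, Sum.inr q.2⟩) (by
        rintro ⟨c, i⟩ ⟨c', i'⟩ h
        cases h
        rfl)
    have h1 := hC _ _ (orthonormal_sum_smul hE (hφ b)) (orthonormal_sum_smul hE' (hφ b)) 1 1
      ContinuousLinearMap.norm_id_le ContinuousLinearMap.norm_id_le Finset.univ
    have hterm : ∀ q : Fin (m b) × Fin (n b),
        ⟪∑ i, φ b q.2 i • v ⟨⟨b, q.1⟩, Sum.inl i⟩, (opFun f A * L - L * opFun f A)
          (∑ i, φ b q.2 i • v ⟨⟨b, q.1⟩, Sum.inr i⟩)⟫_ℂ =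
        c b * ∑ i, ∑ j, star (φ b q.2 i) * divDiff f (s b i) (t b j) * φ b q.2 j := fun q => by
      have hEq : Orthonormal ℂ fun i : Fin (n b) => v ⟨⟨b, q.1⟩, Sum.inl i⟩ :=
        hE.comp (fun i => (q.1, i)) (Prod.mk_right_injective q.1)
      rw [inner_sum_commutator hEq
        (fun i => opFun_apply_of_apply_eq_smul hf hA (hAe ⟨b, q.1⟩ i))
        (fun i => opFun_apply_of_apply_eq_smul hf hA (hAe' ⟨b, q.1⟩ i)) (hLe' ⟨b, q.1⟩)]
      simp only [Finset.mul_sum]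
      refine Finset.sum_congr rfl fun i _ => Finset.sum_congr rfl fun j _ => ?_
      simp only [divDiff]
      push_cast
      ring
    simp only [one_apply_eq_self, hterm, norm_mul, Complex.norm_real, Fintype.sum_prod_type,
      Real.norm_of_nonneg (hc0 b).le] at h1
    rw [Finset.sum_const, ← Finset.mul_sum, Finset.card_univ, Fintype.card_fin, nsmul_eq_mul] at h1
    have hc0b := hc0 b
    calc (2 : ℝ) ^ b = 4 ^ b * (1 / 2) ^ b := by rw [← mul_pow]; norm_num
      _ ≤ 4 ^ b * (m b * (n b * c b)) := by gcongr; exact hm1 b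
      _ = m b * (c b * (4 ^ b * n b)) := by ring
      _ ≤ m b * (c b * _) := by gcongr; exact hlarge b
      _ ≤ C := h1
  obtain ⟨b, hb⟩ := pow_unbounded_of_one_lt C one_lt_two
  exact absurd (hlow b) (not_le.2 hb)

end

theorem mainTheorem3 {H : Type*} [NormedAddCommGroup H] [InnerProductSpace ℂ H] [CompleteSpace H]
    (hH : ¬ FiniteDimensional ℂ H) (f : ℝ → ℂ) (hf : Continuous f)
    (ha : CompactRespectsTraceClass H f) :
    ∀ᶠ x in 𝓝 (0 : ℝ), DifferentiableAt ℝ f x := by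
  by_contra hcon
  rw [not_eventually] at hcon
  refine ha.false_of_nodes hH hf fun b => ?_
  have hball : Metric.ball (0 : ℝ) (1 / ((b : ℝ) + 1)) ∈ 𝓝 (0 : ℝ) :=
    Metric.ball_mem_nhds _ (by positivity)
  obtain ⟨x, hx, hxb⟩ := (hcon.and_eventually hball).exists
  obtain ⟨n, s, t, φ, hn, hs, ht, hst, hφ, hlarge⟩ :=
    exists_nodes_of_not_differentiableAt hf hx (Metric.isOpen_ball.mem_nhds hxb) (4 ^ b)
  refine ⟨n, s, t, φ, hn, fun i => ?_, fun i => ?_, hst, hφ, hlarge⟩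
  · simpa using (mem_ball_zero_iff.1 (hs i)).le
  · simpa using (mem_ball_zero_iff.1 (ht i)).le
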